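/- Let $K$ be a finite abstract simplicial complex (a finite collection of non-empty finite sets, closed under taking non-empty subsets), with $\dim\sigma=\operatorname{card}\sigma-1$, and let $n=\dim K=\max_{\sigma\in K}\dim\sigma$ (so $K\neq\emptyset$). Let $K_p$ be the set of simplices of $K$ of dimension $p$, and let $\preceq$ be the coordinatewise partial order on $\mathbb{R}^k$, with $a\precneqq b$ meaning $a\preceq b$ and $a\ne b$. For $f:K\to\mathbb{R}^k$ and $\sigma\in K_p$ put $$H_f(\sigma)=\{\beta\in K_{p+1}\mid \beta\supset\sigma,\ f(\beta)\preceq f(\sigma)\},\qquad T_f(\sigma)=\{\alpha\in K_{p-1}\mid \alpha\subset\sigma,\ f(\alpha)\succeq f(\sigma)\}.$$ Suppose that $f$ is a multidimensional discrete Morse (mdm) function, that is, for all $p$ and all $\sigma\in K_p$: $\operatorname{card}H_f(\sigma)\le1$; $\operatorname{card}T_f(\sigma)\le1$; every $\beta\in K_{p+1}$ with $\beta\supset\sigma$ and $\beta\notin H_f(\sigma)$ satisfies $f(\beta)\succneqq f(\sigma)$; and every $\alpha\in K_{p-1}$ with $\alpha\subset\sigma$ and $\alpha\notin T_f(\sigma)$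 satisfies $f(\alpha)\precneqq f(\sigma)$. Call $\sigma\in K_p$ critical of index $p$ if $H_f(\sigma)=T_f(\sigma)=\emptyset$, and let $m_p$ be the number of critical simplices of index $p$. Let $R$ be an integral domain (for instance $\mathbb{Z}$ or a field), let $\beta_p(K)$ be the rank over $R$ of the $p$-th simplicial homology module $H_p(K;R)$, let $P_K(t)=\sum_{p\in\mathbb{N}}\beta_p(K)t^p$, and let $\chi(K)=\sum_{\sigma\in K}(-1)^{\dim\sigma}$. Then there is a polynomial $Q(t)$ with non-negative integer coefficients such that $$\sum_{p=0}^{n}m_pt^p=P_K(t)+(1+t)Q(t).$$ Moreover, for all $p=0,1,\dots,n$: 1. (strong Morse inequalities) $m_p-m_{p-1}+\cdots+(-1)^pm_0\ \ge\ \beta_p(K)-\beta_{p-1}(K)+\cdots+(-1)^p\beta_0(K)$; 2. (weak Morse inequalities) $m_p\ge\beta_p(K)$; 3. $m_0-m_1+\cdots+(-1)^nm_n=\beta_0(K)-\beta_1(K)+\cdots+(-1)^n\beta_n(K)=\chi(K)$. -/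

import Mathlib

open Polynomial

noncomputable section

/-! Finite (abstract) simplicial complexes are modelled by Mathlib's `PreAbstractSimplicialComplex`:
a downward closed collection of non-empty finite sets; finiteness is a hypothesis. -/

namespace MDM

/-- The dimension of a simplex. -/
def dim {V : Type*} (σ : Finset V) : ℕ := σ.card - 1

/-- `dim K = n`: the largest dimension of a simplex of `K` is `n` (so `K` is non-empty). -/
def HasDim {V : Type*} (K : PreAbstractSimplicialComplex V) (n : ℕ) : Prop :=
  IsGreatest {d : ℕ | ∃ σ ∈ K, dim σ = d} n

/-- The set `K_p` of the simplices of dimension `p`. -/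
def simplices {V : Type*} (K : PreAbstractSimplicialComplex V) (p : ℕ) : Set (Finset V) :=
  {σ | σ ∈ K ∧ dim σ = p}

/-- `α` is a facet of `β` (and `β` is a cofacet of `α`). -/
def IsFacet {V : Type*} (α β : Finset V) : Prop := α ⊆ β ∧ dim β = dim α + 1

section Morse

variable {V : Type*} {K : PreAbstractSimplicialComplex V} {k : ℕ}

/-- `H_f(σ)`: the cofacets `β` of `σ` in `K` with `f(β) ⪯ f(σ)`; the order on `Fin k → ℝ` is the
coordinatewise one. -/
def H (f : K → Fin k → ℝ) (σ : K) : Set K :=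
  {β | IsFacet (σ : Finset V) (β : Finset V) ∧ f β ≤ f σ}

/-- `T_f(σ)`: the facets `α` of `σ` with `f(α) ⪰ f(σ)`. -/
def T (f : K → Fin k → ℝ) (σ : K) : Set K :=
  {α | IsFacet (α : Finset V) (σ : Finset V) ∧ f σ ≤ f α}

/-- Multidimensional discrete Morse functions `f : K → ℝᵏ`. -/
structure IsMDM (f : K → Fin k → ℝ) : Prop where
  card_H : ∀ σ : K, (H f σ).encard ≤ 1
  card_T : ∀ σ : K, (T f σ).encard ≤ 1
  cofacet : ∀ σ β : K, IsFacet (σ : Finset V) (β : Finset V) → β ∉ H f σ →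
    f σ ≤ f β ∧ f β ≠ f σ
  facet : ∀ σ α : K, IsFacet (α : Finset V) (σ : Finset V) → α ∉ T f σ →
    f α ≤ f σ ∧ f α ≠ f σ

/-- `σ` is a critical simplex of `f`; its index is its dimension. -/
def IsCritical (f : K → Fin k → ℝ) (σ : K) : Prop :=
  (H f σ).encard = 0 ∧ (T f σ).encard = 0

/-- The number `m_p` of critical simplices of index `p`. -/
def numCritical (f : K → Fin k → ℝ) (p : ℕ) : ℕ :=
  {σ : K | IsCritical f σ ∧ dim (σ : Finset V) = p}.ncard

end Morse

section Homology

variable {V : Type*} [LinearOrder V]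

theorem erase_mem_simplices {K : PreAbstractSimplicialComplex V} {p : ℕ} {σ : Finset V}
    (hσ : σ ∈ simplices K (p + 1)) {v : V} (hv : v ∈ σ) : σ.erase v ∈ simplices K p := by
  obtain ⟨h1, h2⟩ := hσ
  have hc : (σ.erase v).card = σ.card - 1 := Finset.card_erase_of_mem hv
  unfold dim at h2
  refine ⟨?_, by unfold dim; omega⟩
  exact (K.isRelLowerSet_faces h1).2 (Finset.erase_subset v σ)
    (Finset.card_pos.mp (by omega))

/-- The simplicial boundary operator on the free modules of simplicial chains (each simplex is
oriented by the order of its vertices),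
`∂[v₀ < ⋯ < v_{p+1}] = ∑ᵢ (-1)ⁱ [v₀, …, v̂ᵢ, …, v_{p+1}]`. -/
def boundary (R : Type*) [CommRing R] (K : PreAbstractSimplicialComplex V) (p : ℕ) :
    (simplices K (p + 1) →₀ R) →ₗ[R] (simplices K p →₀ R) :=
  Finsupp.linearCombination R fun σ : simplices K (p + 1) =>
    ∑ v : {v // v ∈ (σ : Finset V)},
      Finsupp.single (⟨(σ : Finset V).erase v, erase_mem_simplices σ.2 v.2⟩ : simplices K p)
        ((-1 : R) ^ ((σ : Finset V).filter (· < (v : V))).card)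

theorem boundary_comp_boundary (R : Type*) [CommRing R] (K : PreAbstractSimplicialComplex V)
    (p : ℕ) : boundary R K p ∘ₗ boundary R K (p + 1) = 0 := by
  refine Finsupp.lhom_ext' fun σ => LinearMap.ext_ring ?_
  obtain ⟨σ, hσ⟩ := σ
  simp only [boundary, LinearMap.comp_apply, Finsupp.lsingle_apply,
    Finsupp.linearCombination_single, one_smul, map_sum, LinearMap.zero_apply,
    Finset.smul_sum, Finsupp.smul_single, smul_eq_mul]
  rw [Finset.sum_sigma']
  refine Finset.sum_involution
    (fun x _ => ⟨⟨x.2.1, Finset.mem_of_mem_erase x.2.2⟩, ⟨x.1.1, ?_⟩⟩) ?_ ?_ ?_ ?_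
  · exact Finset.mem_erase.mpr ⟨(Finset.ne_of_mem_erase x.2.2).symm, x.1.2⟩
  · rintro ⟨⟨v, hv⟩, ⟨w, hw⟩⟩ _
    have hwv : w ≠ v := Finset.ne_of_mem_erase hw
    have hwσ : w ∈ σ := Finset.mem_of_mem_erase hw
    have key : ∀ a b : V, a ∈ σ → b ∈ σ → a < b →
        (-1 : R) ^ (σ.filter (· < a)).card * (-1) ^ ((σ.erase a).filter (· < b)).card +
        (-1 : R) ^ (σ.filter (· < b)).card * (-1) ^ ((σ.erase b).filter (· < a)).card = 0 := by
      intro a b ha hb hab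
      have e1 : (σ.erase b).filter (· < a) = σ.filter (· < a) := by
        ext x; simp only [Finset.mem_filter, Finset.mem_erase]
        exact ⟨fun h => ⟨h.1.2, h.2⟩, fun h => ⟨⟨(h.2.trans hab).ne, h.1⟩, h.2⟩⟩
      have e2 : ((σ.erase a).filter (· < b)).card + 1 = (σ.filter (· < b)).card := by
        rw [Finset.filter_erase]
        exact Finset.card_erase_add_one (Finset.mem_filter.mpr ⟨ha, hab⟩)
      rw [e1, ← e2, pow_succ]; ring
    simp only [Finset.erase_right_comm (a := w) (b := v), ← Finsupp.single_add]
    rw [Finsupp.single_eq_zero]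
    rcases lt_or_gt_of_ne hwv with h | h
    · rw [add_comm]; exact key w v hwσ hv h
    · exact key v w hv hwσ h
  · rintro ⟨⟨v, hv⟩, ⟨w, hw⟩⟩ _ _ h
    exact Finset.ne_of_mem_erase hw (congrArg (fun x => x.1.1) h)
  · intro _ _; exact Finset.mem_sigma.mpr ⟨Finset.mem_univ _, Finset.mem_univ _⟩
  · intro _ _; rfl

/-- The simplicial chain complex of `K` with coefficients in `R`. -/
def chainComplex (R : Type*) [CommRing R] (K : PreAbstractSimplicialComplex V) :
    ChainComplex (ModuleCat R) ℕ :=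
  ChainComplex.of (fun p => ModuleCat.of R (simplices K p →₀ R))
    (fun p => ModuleCat.ofHom (boundary R K p))
    (fun p => by
      rw [← ModuleCat.ofHom_comp, boundary_comp_boundary]
      rfl)

/-- The `p`-th Betti number: the rank of the `p`-th simplicial homology. -/
def betti (R : Type*) [CommRing R] (K : PreAbstractSimplicialComplex V) (p : ℕ) : ℕ :=
  Module.finrank R ((chainComplex R K).homology p)

/-- The Poincaré polynomial `P_K(t) = ∑_{p ∈ ℕ} β_p(K) t^p` of a finite complex. -/
def poincarePolynomial (R : Type*) [CommRing R] (K : PreAbstractSimplicialComplex V) : ℤ[X] :=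
  ∑ᶠ p : ℕ, C (betti R K p : ℤ) * X ^ p

end Homology

/-- The Euler characteristic `χ(K) = ∑_{σ ∈ K} (-1)^{dim σ}` of a finite complex. -/
def eulerCharacteristic {V : Type*} (K : PreAbstractSimplicialComplex V) : ℤ :=
  ∑ᶠ σ : K, (-1 : ℤ) ^ dim (σ : Finset V)

end MDM

end

namespace MDM

/-! ### Ranks over an integral domain -/

section Rank

open CategoryTheory Cardinal

universe u v

/-! Two decompositions of the number c_p of p-simplices are compared. Linear algebra gives c_p = β_p
+ r_p + r_{p+1}, with r_p the rank of the boundary on p-chains (`betti_add_boundaryRank`). The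
matching of simplices given by `T` and `H` gives c_p = m_p + t_p + t_{p+1}, with t_p the number of
p-simplices matched with a facet (`numCritical_add_numTail`).

The boundaries of those t_p simplices are linearly independent, because `f` makes their matrix
against the matched facets triangular; so t_p ≤ r_p (`numTail_le_boundaryRank`). With q_p = r_p -
t_p ≥ 0 this yields m_p = β_p + q_p + q_{p+1}, and every claim follows by telescoping, with Q = ∑
q_{p+1} t^p. Neither gradient paths nor a Morse complex is needed. -/

theorem finrank_homology_add_finrank_range {R : Type u} [CommRing R] [IsDomain R]
    (S : ShortComplex (ModuleCat.{v} R)) (hS : Module.rank R S.X₂ < ℵ₀) :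
    Module.finrank R S.homology + Module.finrank R (LinearMap.range S.f.hom) +
      Module.finrank R (LinearMap.range S.g.hom) = Module.finrank R S.X₂ := by
  have e₁ : Module.rank R S.homology =
      Module.rank R (LinearMap.ker S.g.hom ⧸ LinearMap.range S.moduleCatToCycles) :=
    S.moduleCatHomologyIso.toLinearEquiv.rank_eq
  have e₂ : Module.rank R (LinearMap.range S.moduleCatToCycles) =
      Module.rank R (LinearMap.range S.f.hom) := by
    have h : LinearMap.range S.f.hom =
        (LinearMap.range S.moduleCatToCycles).map (LinearMap.ker S.g.hom).subtype := by
      rw [← LinearMap.range_comp]; rfl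
    rw [h]
    exact (Submodule.equivMapOfInjective _ (Submodule.injective_subtype _) _).rank_eq
  have e₃ := Submodule.rank_quotient_add_rank (LinearMap.range S.moduleCatToCycles)
  have e₄ := LinearMap.lift_rank_range_add_rank_ker S.g.hom
  simp only [Cardinal.lift_id] at e₄
  -- Every rank involved is finite, so `toNat` respects the cardinal sums.
  have hk : Module.rank R (LinearMap.ker S.g.hom) < ℵ₀ := (Submodule.rank_le _).trans_lt hS
  have hg : Module.rank R (LinearMap.range S.g.hom) < ℵ₀ :=
    (le_self_add.trans e₄.le).trans_lt hS
  rw [← e₁, e₂] at e₃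
  have hh : Module.rank R S.homology < ℵ₀ := (le_self_add.trans e₃.le).trans_lt hk
  have hf : Module.rank R (LinearMap.range S.f.hom) < ℵ₀ :=
    (le_add_self.trans e₃.le).trans_lt hk
  rw [← e₃, add_comm] at e₄
  unfold Module.finrank
  rw [← Cardinal.toNat_add hh hf, ← Cardinal.toNat_add (by rw [e₃]; exact hk) hg, e₄]

/-- In a nontrivial relation, take an index `i` with nonzero coefficient and `u i` maximal. At
coordinate `a i` any other contributing vector would have larger `u`, so only the nonzero diagonal
term survives. A preorder suffices for this. -/
theorem linearIndependent_of_triangular {ι κ R P : Type*} [CommRing R] [IsDomain R]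
    [Preorder P] (v : ι → κ →₀ R) (a : ι → κ) (u : ι → P) (hdiag : ∀ i, v i (a i) ≠ 0)
    (hoff : ∀ i j, i ≠ j → v j (a i) ≠ 0 → u i < u j) : LinearIndependent R v := by
  classical
  rw [linearIndependent_iff']
  intro s g hg
  by_contra! hne
  obtain ⟨i₀, hi₀, hgi₀⟩ := hne
  obtain ⟨i, hi⟩ := (s.filter (g · ≠ 0)).exists_maximalFor u
    ⟨i₀, Finset.mem_filter.mpr ⟨hi₀, hgi₀⟩⟩
  have his := Finset.mem_filter.mp hi.1
  have h := DFunLike.congr_fun hg (a i)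
  rw [Finsupp.finsetSum_apply, Finset.sum_eq_single i] at h
  · simp only [Finsupp.smul_apply, smul_eq_mul, Finsupp.zero_apply, mul_eq_zero] at h
    exact h.elim his.2 (hdiag i)
  · intro j hj hji
    by_cases hgj : g j = 0
    · simp [hgj]
    by_cases hv : v j (a i) = 0
    · simp [hv]
    · have hlt := hoff i j hji.symm hv
      exact absurd hlt (not_lt_of_ge (hi.2 (Finset.mem_filter.mpr ⟨hj, hgj⟩) hlt.le))
  · exact fun h' => absurd his.1 h'

end Rank

/-! ### Telescoping sums -/

section Arithmetic

/-- Truncating at `N` splits the pair q_N (X^(N-1) + X^N); the extra term on the left restores it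
and lets the induction run. -/
theorem morse_polynomial_identity {m b q : ℕ → ℕ} (hm : ∀ p, m p = b p + q p + q (p + 1))
    (h0 : q 0 = 0) (N : ℕ) :
    ∑ p ∈ Finset.range N, C (m p : ℤ) * X ^ p + C (q N : ℤ) * X ^ N =
      ∑ p ∈ Finset.range N, C (b p : ℤ) * X ^ p +
        (1 + X) * ∑ p ∈ Finset.range N, C (q (p + 1) : ℤ) * X ^ p := by
  induction N with
  | zero => simp [h0]
  | succ N ih =>
    simp only [Finset.sum_range_succ, hm N, Nat.cast_add, C_add] at ih ⊢
    linear_combination ih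

theorem alternating_sum_eq {m b q : ℕ → ℕ} (hm : ∀ p, m p = b p + q p + q (p + 1))
    (h0 : q 0 = 0) (p : ℕ) :
    ∑ i ∈ Finset.range (p + 1), (-1 : ℤ) ^ (p - i) * (m i : ℤ) =
      ∑ i ∈ Finset.range (p + 1), (-1 : ℤ) ^ (p - i) * (b i : ℤ) + q (p + 1) := by
  have key : ∀ (a : ℕ → ℤ) (p : ℕ), ∑ i ∈ Finset.range (p + 2), (-1 : ℤ) ^ (p + 1 - i) * a i =
      a (p + 1) - ∑ i ∈ Finset.range (p + 1), (-1 : ℤ) ^ (p - i) * a i := by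
    intro a p
    rw [Finset.sum_range_succ, Nat.sub_self, pow_zero, one_mul, add_comm, sub_eq_add_neg,
      ← Finset.sum_neg_distrib]
    congr 1
    refine Finset.sum_congr rfl fun i hi => ?_
    rw [Nat.sub_add_comm (Nat.lt_succ_iff.mp (Finset.mem_range.mp hi)), pow_succ]
    ring
  induction p with
  | zero => simp [hm, h0]
  | succ p ih =>
    rw [key, key, ih, hm (p + 1)]
    push_cast
    ring

theorem euler_sum_eq {m b q : ℕ → ℕ} (hm : ∀ p, m p = b p + q p + q (p + 1))
    (h0 : q 0 = 0) (N : ℕ) :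
    ∑ p ∈ Finset.range N, (-1 : ℤ) ^ p * (m p : ℤ) =
      ∑ p ∈ Finset.range N, (-1 : ℤ) ^ p * (b p : ℤ) - (-1) ^ N * (q N : ℤ) := by
  induction N with
  | zero => simp [h0]
  | succ N ih =>
    rw [Finset.sum_range_succ, Finset.sum_range_succ, ih, hm N]
    push_cast
    ring

end Arithmetic

/-! ### The matching induced by `f` -/

section Matching

variable {V : Type*} {K : PreAbstractSimplicialComplex V} {k : ℕ} {f : K → Fin k → ℝ}

theorem finite_simplices {K : PreAbstractSimplicialComplex V} (hK : K.faces.Finite) (p : ℕ) :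
    (simplices K p).Finite :=
  hK.subset fun _ h => h.1

theorem finrank_chains {R : Type*} [CommRing R] [IsDomain R] {K : PreAbstractSimplicialComplex V}
    (hK : K.faces.Finite) (p : ℕ) :
    Module.finrank R (simplices K p →₀ R) = (simplices K p).ncard := by
  have := (finite_simplices hK p).fintype
  rw [Module.finrank_finsupp_self, Set.ncard_eq_toFinset_card', Set.toFinset_card]

theorem nonempty_of_mem {K : PreAbstractSimplicialComplex V} {σ : Finset V} (h : σ ∈ K) :
    σ.Nonempty :=
  (K.isRelLowerSet_faces h).1

theorem ncard_simplices_eq_zero {n : ℕ} (hn : HasDim K n) {p : ℕ} (hp : n < p) :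
    (simplices K p).ncard = 0 := by
  have : simplices K p = ∅ := by
    ext σ
    simp only [Set.mem_empty_iff_false, iff_false]
    rintro ⟨h, h'⟩
    exact absurd (hn.2 ⟨σ, h, h'⟩) (not_le.mpr hp)
  rw [this, Set.ncard_empty]

theorem eulerCharacteristic_eq_sum (hK : K.faces.Finite) {n : ℕ} (hn : HasDim K n) :
    eulerCharacteristic K =
      ∑ p ∈ Finset.range (n + 1), (-1 : ℤ) ^ p * ((simplices K p).ncard : ℤ) := by
  classical
  have : Fintype K := hK.fintype
  rw [eulerCharacteristic, finsum_eq_sum_of_fintype,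
    ← Finset.sum_fiberwise_of_maps_to (g := fun σ : K => dim (σ : Finset V))
      (t := Finset.range (n + 1))
      fun σ _ => Finset.mem_range.mpr (Nat.lt_succ_of_le (hn.2 ⟨σ, σ.2, rfl⟩))]
  refine Finset.sum_congr rfl fun p _ => ?_
  rw [Finset.sum_congr rfl fun σ hσ => by rw [(Finset.mem_filter.mp hσ).2], Finset.sum_const,
    nsmul_eq_mul, mul_comm]
  congr 2
  rw [← Set.ncard_coe_finset,
    ← Set.ncard_image_of_injective _ (Subtype.val_injective (p := (· ∈ K)))]
  congr 1
  ext σ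
  simp [simplices, and_comm]

theorem IsMDM.eq_of_mem_T (hf : IsMDM f) {σ α α' : K} (h : α ∈ T f σ) (h' : α' ∈ T f σ) :
    α = α' :=
  Set.encard_le_one_iff.mp (hf.card_T σ) _ _ h h'

theorem IsMDM.eq_of_mem_H (hf : IsMDM f) {σ β β' : K} (h : β ∈ H f σ) (h' : β' ∈ H f σ) :
    β = β' :=
  Set.encard_le_one_iff.mp (hf.card_H σ) _ _ h h'

theorem IsMDM.lt_of_isFacet (hf : IsMDM f) {α σ : K} (h : IsFacet (α : Finset V) (σ : Finset V))
    (hα : α ∉ T f σ) : f α < f σ :=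
  lt_of_le_of_ne (hf.facet σ α h hα).1 (hf.facet σ α h hα).2

/-- The number of `p`-simplices that are matched with one of their facets. -/
noncomputable def numTail (f : K → Fin k → ℝ) (p : ℕ) : ℕ :=
  {σ : K | (T f σ).Nonempty ∧ dim (σ : Finset V) = p}.ncard

/-- `β ∈ H f α` and `α ∈ T f β` are the same condition by definition, and the cardinality bounds
make this relation a bijection between its two sides. -/
theorem ncard_H_nonempty (hf : IsMDM f) (p : ℕ) :
    {σ : K | (H f σ).Nonempty ∧ dim (σ : Finset V) = p}.ncard = numTail f (p + 1) := by
  refine Set.ncard_congr (fun σ hσ => hσ.1.some) ?_ ?_ ?_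
  · intro σ hσ
    exact ⟨⟨σ, hσ.1.some_mem⟩, by rw [hσ.1.some_mem.1.2, hσ.2]⟩
  · intro σ τ hσ hτ h
    have h' : hσ.1.some ∈ H f τ := h ▸ hτ.1.some_mem
    exact hf.eq_of_mem_T hσ.1.some_mem h'
  · rintro β ⟨⟨α, hα⟩, hβ⟩
    have hαH : β ∈ H f α := hα
    refine ⟨α, ⟨⟨β, hαH⟩, ?_⟩, hf.eq_of_mem_H (Set.Nonempty.some_mem _) hαH⟩
    have := hα.1.2
    omega

theorem numTail_zero (f : K → Fin k → ℝ) : numTail f 0 = 0 := by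
  have : {σ : K | (T f σ).Nonempty ∧ dim (σ : Finset V) = 0} = ∅ := by
    ext σ
    simp only [Set.mem_ofPred_eq, Set.mem_empty_iff_false, iff_false]
    rintro ⟨⟨α, hα⟩, h⟩
    have := hα.1.2
    omega
  rw [numTail, this, Set.ncard_empty]

end Matching

/-! ### Betti numbers and boundary coefficients -/

section Betti

open CategoryTheory

variable {V : Type*} [LinearOrder V]

/-- The rank of the boundary operator on the `p`-chains of `K`, which is `0` for `p = 0`. -/
noncomputable def boundaryRank (R : Type*) [CommRing R] (K : PreAbstractSimplicialComplex V) : ℕ → ℕ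
  | 0 => 0
  | p + 1 => Module.finrank R (LinearMap.range (boundary R K p))

theorem chainComplex_d (R : Type*) [CommRing R] (K : PreAbstractSimplicialComplex V) (p : ℕ) :
    (chainComplex R K).d (p + 1) p = ModuleCat.ofHom (boundary R K p) :=
  ChainComplex.of_d (fun p => ModuleCat.of R (simplices K p →₀ R))
    (fun p => ModuleCat.ofHom (boundary R K p)) p

theorem betti_add_boundaryRank (R : Type*) [CommRing R] [IsDomain R]
    {K : PreAbstractSimplicialComplex V} (hK : K.faces.Finite) (p : ℕ) :
    betti R K p + boundaryRank R K p + boundaryRank R K (p + 1) = (simplices K p).ncard := by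
  have := (finite_simplices hK p).fintype
  rw [← finrank_chains (R := R) hK p]
  have hrank : Module.rank R (simplices K p →₀ R) < Cardinal.aleph0 := Module.rank_lt_aleph0 _ _
  have hd := congrArg (fun φ => Module.finrank R (LinearMap.range φ.hom)) (chainComplex_d R K p)
  cases p with
  | zero =>
    -- In degree 0 the successor index is again 0, and the outgoing differential vanishes.
    have h := finrank_homology_add_finrank_range ((chainComplex R K).sc' 1 0 0) hrank
    have e := ((chainComplex R K).homologyIsoSc' 1 0 0 (by simp)
      (by simp)).toLinearEquiv.finrank_eq
    have hg : Module.finrank R (LinearMap.range ((chainComplex R K).sc' 1 0 0).g.hom) = 0 := by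
      have : ((chainComplex R K).sc' 1 0 0).g = 0 := (chainComplex R K).shape _ _ (by simp)
      rw [this]
      exact (congrArg (fun N : Submodule R _ => Module.finrank R N) LinearMap.range_zero).trans
        (finrank_bot R _)
    rw [← e, hg] at h
    exact ((congrArg _ hd.symm).trans h)
  | succ p =>
    have h := finrank_homology_add_finrank_range ((chainComplex R K).sc' (p + 2) (p + 1) p) hrank
    have e := ((chainComplex R K).homologyIsoSc' (p + 2) (p + 1) p (by simp)
      (by simp)).toLinearEquiv.finrank_eq
    have hd' := congrArg (fun φ => Module.finrank R (LinearMap.range φ.hom))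
      (chainComplex_d R K p)
    rw [← e, add_right_comm] at h
    refine Eq.trans ?_ h
    exact congrArg₂ _ (congrArg _ hd'.symm) hd.symm

theorem boundary_single_apply (R : Type*) [CommRing R] {K : PreAbstractSimplicialComplex V}
    {p : ℕ} (β : simplices K (p + 1)) (α : simplices K p) :
    boundary R K p (Finsupp.single β 1) α = ∑ v : {v // v ∈ (β : Finset V)},
      if (β : Finset V).erase v = α then
        (-1 : R) ^ ((β : Finset V).filter (· < (v : V))).card else 0 := by
  rw [boundary, Finsupp.linearCombination_single, one_smul, Finsupp.finsetSum_apply]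
  refine Finset.sum_congr rfl fun v _ => ?_
  rw [Finsupp.single_apply]
  exact if_congr Subtype.ext_iff rfl rfl

theorem isFacet_of_boundary_ne_zero {R : Type*} [CommRing R] {K : PreAbstractSimplicialComplex V}
    {p : ℕ} {β : simplices K (p + 1)} {α : simplices K p}
    (h : boundary R K p (Finsupp.single β 1) α ≠ 0) :
    IsFacet (α : Finset V) (β : Finset V) := by
  rw [boundary_single_apply] at h
  obtain ⟨v, -, hv⟩ := Finset.exists_ne_zero_of_sum_ne_zero h
  rw [ne_eq, ite_eq_right_iff, Classical.not_imp] at hv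
  refine ⟨hv.1 ▸ Finset.erase_subset _ _, ?_⟩
  rw [β.2.2, α.2.2]

/-- Nonemptiness matters: with truncated subtraction `dim ∅ = 0`, so `∅` would count as a facet of
an edge. -/
theorem exists_erase_eq_of_isFacet {α β : Finset V} (hα : α.Nonempty) (h : IsFacet α β) :
    ∃ v ∈ β, β.erase v = α := by
  have hc := hα.card_pos
  obtain ⟨h₁, h₂⟩ := h
  unfold dim at h₂
  obtain ⟨v, hv⟩ := Finset.card_eq_one.mp
    (show (β \ α).card = 1 by rw [Finset.card_sdiff_of_subset h₁]; omega)
  refine ⟨v, (Finset.mem_sdiff.mp (hv ▸ Finset.mem_singleton_self v)).1, ?_⟩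
  rw [← Finset.sdiff_singleton_eq_erase, ← hv, Finset.sdiff_sdiff_eq_self h₁]

/-- Exactly one vertex removal produces the facet, so the coefficient is ±1. -/
theorem boundary_ne_zero_of_isFacet (R : Type*) [CommRing R] [IsDomain R]
    {K : PreAbstractSimplicialComplex V} {p : ℕ} {β : simplices K (p + 1)} {α : simplices K p}
    (h : IsFacet (α : Finset V) (β : Finset V)) :
    boundary R K p (Finsupp.single β 1) α ≠ 0 := by
  obtain ⟨v, hv, hvα⟩ := exists_erase_eq_of_isFacet (nonempty_of_mem α.2.1) h
  rw [boundary_single_apply, Finset.sum_eq_single ⟨v, hv⟩, if_pos hvα]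
  · exact pow_ne_zero _ (neg_ne_zero.mpr one_ne_zero)
  · intro w _ hw
    refine if_neg fun hwα => hw (Subtype.ext ?_)
    exact (Finset.erase_inj _ w.2).mp (hwα.trans hvα.symm)
  · simp

end Betti

/-! ### Counting critical and matched simplices -/

section Count

variable {V : Type*} [LinearOrder V] {K : PreAbstractSimplicialComplex V} {k : ℕ}
  {f : K → Fin k → ℝ}

/-- Two vertices can be removed from a simplex in either order. -/
theorem exists_other_intermediate {α σ β : K} (h₁ : IsFacet (α : Finset V) (σ : Finset V))
    (h₂ : IsFacet (σ : Finset V) (β : Finset V)) :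
    ∃ τ : K, τ ≠ σ ∧ IsFacet (α : Finset V) (τ : Finset V) ∧
      IsFacet (τ : Finset V) (β : Finset V) := by
  obtain ⟨v, hv, hvα⟩ := exists_erase_eq_of_isFacet (nonempty_of_mem α.2) h₁
  obtain ⟨w, hw, hwσ⟩ := exists_erase_eq_of_isFacet (nonempty_of_mem σ.2) h₂
  have hvβ : v ∈ (β : Finset V) := h₂.1 hv
  have hwv : w ≠ v := by
    rintro rfl
    exact Finset.notMem_erase w _ (hwσ ▸ hv)
  have hwmem : w ∈ (β : Finset V).erase v := Finset.mem_erase.mpr ⟨hwv, hw⟩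
  have hτ : (β : Finset V).erase v ∈ K :=
    (K.isRelLowerSet_faces β.2).2 (Finset.erase_subset _ _) ⟨w, hwmem⟩
  have hd₁ := h₁.2
  have hd₂ := h₂.2
  have hτd : dim ((β : Finset V).erase v) = dim (σ : Finset V) := by
    unfold dim at hd₂ ⊢
    rw [Finset.card_erase_of_mem hvβ]
    omega
  refine ⟨⟨_, hτ⟩, fun h => ?_, ⟨?_, ?_⟩, Finset.erase_subset _ _, ?_⟩
  · have h' : (β : Finset V).erase v = σ := congrArg Subtype.val h
    exact Finset.notMem_erase v _ (h' ▸ hv)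
  · rw [← hvα, ← hwσ]
    exact Finset.erase_subset_erase _ (Finset.erase_subset _ _)
  · rw [hτd, hd₁]
  · rw [hτd, hd₂]

/-- No simplex is matched both with a facet and with a cofacet. -/
theorem IsMDM.T_eq_empty_of_H_nonempty (hf : IsMDM f) {σ : K} (hH : (H f σ).Nonempty) :
    T f σ = ∅ := by
  by_contra hT
  obtain ⟨β, hβ⟩ := hH
  obtain ⟨α, hα⟩ := Set.nonempty_iff_ne_empty.mpr hT
  obtain ⟨τ, hτ, hατ, hτβ⟩ := exists_other_intermediate hα.1 hβ.1
  have h₁ : f α < f τ := hf.lt_of_isFacet hατ fun h => hτ (hf.eq_of_mem_H (σ := α) h hα)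
  have h₂ : f τ < f β := hf.lt_of_isFacet hτβ fun h => hτ (hf.eq_of_mem_T h hβ)
  -- The cycle is f α < f τ < f β ≤ f σ ≤ f α.
  exact absurd ((h₁.trans h₂).trans_le (hβ.2.trans hα.2)) (lt_irrefl _)

/-- The p-simplices split into critical ones, those matched with a facet and those matched with a
cofacet; the last are counted by their partners in dimension p + 1. -/
theorem numCritical_add_numTail (hK : K.faces.Finite) (hf : IsMDM f) (p : ℕ) :
    numCritical f p + numTail f p + numTail f (p + 1) = (simplices K p).ncard := by
  have : Finite K := hK.to_subtype
  rw [← ncard_H_nonempty hf, numCritical, numTail, ← Set.ncard_union_eq, ← Set.ncard_union_eq,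
    ← Set.ncard_image_of_injective _ (Subtype.val_injective (p := (· ∈ K)))]
  · congr 1
    ext σ
    simp only [Set.mem_image, Set.mem_union, Set.mem_ofPred_eq, IsCritical, Set.encard_eq_zero,
      simplices, Set.nonempty_iff_ne_empty]
    constructor
    · rintro ⟨τ, h, rfl⟩
      exact ⟨τ.2, by tauto⟩
    · rintro ⟨h, hd⟩
      exact ⟨⟨σ, h⟩, by tauto, rfl⟩
  · rw [Set.disjoint_left]
    rintro σ (h | h) h'
    · exact h'.1.ne_empty (Set.encard_eq_zero.mp h.1.1)
    · exact h.1.ne_empty (hf.T_eq_empty_of_H_nonempty h'.1)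
  · rw [Set.disjoint_left]
    intro σ h h'
    exact h'.1.ne_empty (Set.encard_eq_zero.mp h.1.2)

/-- The boundaries of the matched `p`-simplices are linearly independent, by triangularity. -/
theorem numTail_le_boundaryRank (R : Type*) [CommRing R] [IsDomain R] (hK : K.faces.Finite)
    (hf : IsMDM f) (p : ℕ) : numTail f p ≤ boundaryRank R K p := by
  cases p with
  | zero => rw [numTail_zero, boundaryRank]
  | succ p =>
    have := (finite_simplices hK p).fintype
    have : Finite K := hK.to_subtype
    let S : Set K := {σ | (T f σ).Nonempty ∧ dim (σ : Finset V) = p + 1}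
    have : Fintype S := Fintype.ofFinite S
    let a : S → K := fun σ => σ.2.1.some
    have ha : ∀ σ : S, a σ ∈ T f σ := fun σ => σ.2.1.some_mem
    have had : ∀ σ : S, (a σ : Finset V) ∈ simplices K p := fun σ => by
      refine ⟨(a σ).2, ?_⟩
      have h₁ := (ha σ).1.2
      have h₂ := σ.2.2
      omega
    let b : S → simplices K (p + 1) := fun σ => ⟨(σ : K), σ.1.2, σ.2.2⟩
    have hli : LinearIndependent R fun σ : S => boundary R K p (Finsupp.single (b σ) 1) := by
      refine linearIndependent_of_triangular _ (fun σ => ⟨a σ, had σ⟩) (fun σ => f (a σ))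
        (fun σ => boundary_ne_zero_of_isFacet R (ha σ).1) fun σ τ hστ h => ?_
      -- If σ ≠ τ and a σ is a facet of τ, then it is not in `T f τ`, since σ is the only element of
      -- `H f (a σ)`. Hence f (a σ) < f τ ≤ f (a τ).
      have hfac : IsFacet (a σ : Finset V) (τ : Finset V) := isFacet_of_boundary_ne_zero h
      refine (hf.lt_of_isFacet hfac fun hT => hστ (Subtype.ext ?_)).trans_le (ha τ).2
      exact hf.eq_of_mem_H (σ := a σ) (ha σ) hT
    have hli' : LinearIndependent R fun σ : S =>
        (⟨_, LinearMap.mem_range_self (boundary R K p) (Finsupp.single (b σ) 1)⟩ :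
          LinearMap.range (boundary R K p)) :=
      LinearIndependent.of_comp (LinearMap.range (boundary R K p)).subtype hli
    have hle := hli'.cardinal_lift_le_rank
    have hlt : Module.rank R (LinearMap.range (boundary R K p)) < Cardinal.aleph0 :=
      (Submodule.rank_le _).trans_lt (Module.rank_lt_aleph0 _ _)
    have h := Cardinal.toNat_le_toNat hle (Cardinal.lift_lt_aleph0.mpr hlt)
    rw [Cardinal.toNat_lift, Cardinal.toNat_lift, ← Nat.card, Nat.card_coe_set_eq] at h
    exact h

theorem poincarePolynomial_eq_sum (R : Type*) [CommRing R] [IsDomain R] (hK : K.faces.Finite)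
    {n : ℕ} (hn : HasDim K n) :
    poincarePolynomial R K = ∑ p ∈ Finset.range (n + 1), C (betti R K p : ℤ) * X ^ p := by
  refine finsum_eq_sum_of_support_subset _ fun p hp => ?_
  by_contra hpn
  have h₀ := ncard_simplices_eq_zero hn (p := p) (by simpa using hpn)
  have h := betti_add_boundaryRank R hK p
  have hb : betti R K p = 0 := by omega
  exact hp (by simp [hb])

end Count

end MDM

theorem mainTheorem5 {V : Type*} [LinearOrder V] (K : PreAbstractSimplicialComplex V)
    (hK : K.faces.Finite) (n : ℕ) (hn : MDM.HasDim K n)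
    (k : ℕ) (f : K → Fin k → ℝ) (hf : MDM.IsMDM f)
    (R : Type*) [CommRing R] [IsDomain R] :
    -- the Morse equation
    (∃ Q : ℤ[X], (∀ i, 0 ≤ Q.coeff i) ∧
      ∑ p ∈ Finset.range (n + 1), C (MDM.numCritical f p : ℤ) * X ^ p =
        MDM.poincarePolynomial R K + (1 + X) * Q) ∧
    -- the strong Morse inequalities
    (∀ p ≤ n, ∑ i ∈ Finset.range (p + 1), (-1 : ℤ) ^ (p - i) * (MDM.betti R K i : ℤ) ≤
      ∑ i ∈ Finset.range (p + 1), (-1 : ℤ) ^ (p - i) * (MDM.numCritical f i : ℤ)) ∧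
    -- the weak Morse inequalities
    (∀ p ≤ n, MDM.betti R K p ≤ MDM.numCritical f p) ∧
    -- the Euler characteristic
    (∑ p ∈ Finset.range (n + 1), (-1 : ℤ) ^ p * (MDM.numCritical f p : ℤ) =
      ∑ p ∈ Finset.range (n + 1), (-1 : ℤ) ^ p * (MDM.betti R K p : ℤ) ∧
     ∑ p ∈ Finset.range (n + 1), (-1 : ℤ) ^ p * (MDM.betti R K p : ℤ) =
      MDM.eulerCharacteristic K) := by
  set b := MDM.betti R K
  set m := MDM.numCritical f
  -- The natural subtraction loses nothing, by `numTail_le_boundaryRank`.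
  set q : ℕ → ℕ := fun p => MDM.boundaryRank R K p - MDM.numTail f p
  have hm : ∀ p, m p = b p + q p + q (p + 1) := fun p => by
    have h₁ := MDM.betti_add_boundaryRank R hK p
    have h₂ := MDM.numCritical_add_numTail hK hf p
    have h₃ := MDM.numTail_le_boundaryRank R hK hf p
    have h₄ := MDM.numTail_le_boundaryRank R hK hf (p + 1)
    simp only [m, b, q]
    omega
  have h0 : q 0 = 0 := Nat.zero_sub _
  -- There are no (n+1)-simplices, so the remainder terms of the telescoping sums vanish at n + 1.
  have hr : MDM.boundaryRank R K (n + 1) = 0 := by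
    have h₁ := MDM.betti_add_boundaryRank R hK (n + 1)
    have h₂ := MDM.ncard_simplices_eq_zero hn n.lt_add_one
    omega
  have hq : q (n + 1) = 0 := by simp only [q, hr, Nat.zero_sub]
  refine ⟨⟨∑ p ∈ Finset.range (n + 1), C (q (p + 1) : ℤ) * X ^ p, fun i => ?_, ?_⟩,
    fun p _ => ?_, fun p _ => ?_, ?_, ?_⟩
  · simp only [finsetSum_coeff, coeff_C_mul_X_pow]
    exact Finset.sum_nonneg fun p _ => by split_ifs <;> positivity
  · have h := MDM.morse_polynomial_identity hm h0 (n + 1)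
    rwa [hq, Nat.cast_zero, C_0, zero_mul, add_zero,
      ← MDM.poincarePolynomial_eq_sum R hK hn] at h
  · rw [MDM.alternating_sum_eq hm h0 p]
    exact le_add_of_nonneg_right (Int.natCast_nonneg _)
  · have := hm p
    omega
  · rw [MDM.euler_sum_eq hm h0, hq, Nat.cast_zero, mul_zero, sub_zero]
  · have hc : ∀ p, (MDM.simplices K p).ncard =
        b p + MDM.boundaryRank R K p + MDM.boundaryRank R K (p + 1) :=
      fun p => (MDM.betti_add_boundaryRank R hK p).symm
    rw [MDM.eulerCharacteristic_eq_sum hK hn, MDM.euler_sum_eq hc rfl, hr, Nat.cast_zero,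
      mul_zero, sub_zero]
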